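/- Let $n\ge 0$ be an integer and let $u_0\in\mathcal S'(\mathbb R^n)$ be a tempered distribution. For $t\in\mathbb R$ let $e^{it\Delta}u_0\in\mathcal S'(\mathbb R^n)$ be the solution at time $t$ of the free Schrödinger equation $\partial_t u=i\Delta u$, $u(\cdot,0)=u_0$, i.e. $\widehat{e^{it\Delta}u_0}=e^{-it|\xi|^2}\,\widehat{u_0}$, where $\widehat{\ \cdot\ }$ is the Fourier transform of tempered distributions, normalized by $\widehat f(\xi)=(2\pi)^{-n/2}\int_{\mathbb R^n}e^{-ix\cdot\xi}f(x)\,dx$. Suppose that there are real numbers $t_1\ne t_2$ and $\mu_1,\mu_2>0$ such that $$e^{it_j\Delta}u_0\in L^2(\mathbb R^n,\,e^{2\mu_j|x|^2}dx),\qquad j=1,2.$$ Then there are $A_1,A_2>0$ such that $u_0\in O_2(A_1;A_2)$, i.e. $u_0$ and $\widehat{u_0}$ are functions with $$e^{A_1|x|^2}u_0\in L^2(\mathbb R^n)\quad\text{and}\quad e^{A_2|\xi|^2}\,\widehat{u_0}\in L^2(\mathbb R^n).$$ -/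

import Mathlib

open MeasureTheory
open scoped SchwartzMap ENNReal FourierTransform

noncomputable section

/-! ### The Fourier transform with the normalization `(2π)^{-n/2} ∫ e^{-i x·ξ} f(x) dx` -/

/-- The dilation `x ↦ (2π)⁻¹ x` of `ℝⁿ`. -/
def dilationInvTwoPi (n : ℕ) :
    EuclideanSpace ℝ (Fin n) ≃L[ℝ] EuclideanSpace ℝ (Fin n) :=
  (LinearEquiv.smulOfNeZero ℝ (EuclideanSpace ℝ (Fin n)) ((2 * Real.pi)⁻¹)
    (inv_ne_zero Real.two_pi_pos.ne')).toContinuousLinearEquiv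

/-- The unitary Fourier transform in angular frequency on Schwartz functions,
`φ̂(ξ) = (2π)^{-n/2} ∫ e^{-i x·ξ} φ(x) dx`, obtained from Mathlib's `𝓕`
(which has the kernel `e^{-2π i x·ξ}`) by rescaling; see `hatSchwartz_apply`. -/
def hatSchwartz (n : ℕ) :
    𝓢(EuclideanSpace ℝ (Fin n), ℂ) →L[ℂ] 𝓢(EuclideanSpace ℝ (Fin n), ℂ) :=
  (((2 * Real.pi) ^ (-(n : ℝ) / 2) : ℝ) : ℂ) •
    (SchwartzMap.compCLMOfContinuousLinearEquiv ℂ (dilationInvTwoPi n) ∘L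
      FourierTransform.fourierCLM ℂ 𝓢(EuclideanSpace ℝ (Fin n), ℂ))

theorem hatSchwartz_apply (n : ℕ) (φ : 𝓢(EuclideanSpace ℝ (Fin n), ℂ))
    (ξ : EuclideanSpace ℝ (Fin n)) :
    hatSchwartz n φ ξ = (((2 * Real.pi) ^ (-(n : ℝ) / 2) : ℝ) : ℂ) *
      ∫ x, Complex.exp (-Complex.I * ((inner ℝ x ξ : ℝ) : ℂ)) * φ x := by
  have h : hatSchwartz n φ ξ = (((2 * Real.pi) ^ (-(n : ℝ) / 2) : ℝ) : ℂ) *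
      (𝓕 (φ : EuclideanSpace ℝ (Fin n) → ℂ)) ((2 * Real.pi)⁻¹ • ξ) := rfl
  rw [h, Real.fourier_eq']
  congr 1
  refine integral_congr_ae (Filter.Eventually.of_forall fun x => ?_)
  have hpi : (2 * Real.pi) ≠ 0 := Real.two_pi_pos.ne'
  have : -2 * Real.pi * inner ℝ x ((2 * Real.pi)⁻¹ • ξ) = -inner ℝ x ξ := by
    rw [inner_smul_right]; field_simp
  simp only [this, smul_eq_mul]
  congr 2
  push_cast
  ring

/-- The Fourier transform of a tempered distribution, by duality: `⟨û, φ⟩ = ⟨u, φ̂⟩`. -/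
def hatTempered (n : ℕ) (u : 𝓢'(EuclideanSpace ℝ (Fin n), ℂ)) :
    𝓢'(EuclideanSpace ℝ (Fin n), ℂ) :=
  PointwiseConvergenceCLM.precomp ℂ (hatSchwartz n) u

theorem hatTempered_apply (n : ℕ) (u : 𝓢'(EuclideanSpace ℝ (Fin n), ℂ))
    (φ : 𝓢(EuclideanSpace ℝ (Fin n), ℂ)) :
    hatTempered n u φ = u (hatSchwartz n φ) := rfl

/-! ### The free Schrödinger group -/

/-- The symbol of `e^{itΔ}` in the frequency variable of Mathlib's `𝓕`. Here `Δ` has the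
symbol `-|2πξ|²`, so `e^{itΔ}` has the symbol `e^{-it|2πξ|²}`. -/
def freeSymbol (n : ℕ) (t : ℝ) (ξ : EuclideanSpace ℝ (Fin n)) : ℂ :=
  Complex.exp (((-(t * (2 * Real.pi) ^ 2) * ‖ξ‖ ^ 2 : ℝ) : ℂ) * Complex.I)

theorem hasTemperateGrowth_exp_mul_I :
    (fun s : ℝ => Complex.exp ((s : ℂ) * Complex.I)).HasTemperateGrowth := by
  have hd : ∀ k : ℕ, iteratedDeriv k (fun s : ℝ => Complex.exp ((s : ℂ) * Complex.I)) =
      fun s : ℝ => Complex.I ^ k * Complex.exp ((s : ℂ) * Complex.I) := by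
    intro k
    induction k with
    | zero => simp
    | succ k ih =>
      rw [iteratedDeriv_succ, ih]
      funext s
      have h1 : HasDerivAt (fun s : ℝ => (s : ℂ) * Complex.I) Complex.I s := by
        simpa using (Complex.ofRealCLM.hasDerivAt (x := s)).mul_const Complex.I
      have h2 := (h1.cexp).const_mul (Complex.I ^ k)
      rw [h2.deriv]
      ring
  refine ⟨?_, fun k => ⟨0, 1, fun s => ?_⟩⟩
  · exact Complex.contDiff_exp.comp (Complex.ofRealCLM.contDiff.mul contDiff_const)
  · rw [norm_iteratedFDeriv_eq_norm_iteratedDeriv, hd]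
    simp [Complex.norm_exp_ofReal_mul_I]

/-- The symbol is smooth with polynomially bounded derivatives, so that it acts on tempered
distributions by multiplication. -/
theorem freeSymbol_hasTemperateGrowth (n : ℕ) (t : ℝ) :
    (freeSymbol n t).HasTemperateGrowth := by
  have h : (fun ξ : EuclideanSpace ℝ (Fin n) =>
      -(t * (2 * Real.pi) ^ 2) * ‖ξ‖ ^ 2).HasTemperateGrowth :=
    (Function.HasTemperateGrowth.const _).mul
      (Function.hasTemperateGrowth_norm_sq (EuclideanSpace ℝ (Fin n)))
  exact hasTemperateGrowth_exp_mul_I.comp h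

/-- The free Schrödinger evolution `e^{itΔ} u` of a tempered distribution `u`, that is, the
Fourier multiplier with the symbol of `e^{itΔ}`. -/
def freeSchrodinger (n : ℕ) (t : ℝ) (u : 𝓢'(EuclideanSpace ℝ (Fin n), ℂ)) :
    𝓢'(EuclideanSpace ℝ (Fin n), ℂ) :=
  TemperedDistribution.fourierMultiplierCLM ℂ (freeSymbol n t) u

/-! ### Gaussian decay of tempered distributions -/

/-- The tempered distribution `u` is given by integration against the function `f`. -/
def IsGivenBy {n : ℕ} (u : 𝓢'(EuclideanSpace ℝ (Fin n), ℂ))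
    (f : EuclideanSpace ℝ (Fin n) → ℂ) : Prop :=
  ∀ φ : 𝓢(EuclideanSpace ℝ (Fin n), ℂ),
    Integrable (fun x => φ x * f x) ∧ u φ = ∫ x, φ x * f x

/-- `u ∈ L²(e^{b|x|²} dx)`: the tempered distribution `u` is a function which is square
integrable with respect to the measure `e^{b|x|²} dx`. -/
def MemGaussianWeightedL2 {n : ℕ} (b : ℝ) (u : 𝓢'(EuclideanSpace ℝ (Fin n), ℂ)) : Prop :=
  ∃ f : EuclideanSpace ℝ (Fin n) → ℂ, IsGivenBy u f ∧
    MemLp f 2 (volume.withDensity fun x => ENNReal.ofReal (Real.exp (b * ‖x‖ ^ 2)))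

/-- `e^{A|·|²} u ∈ L^p(ℝⁿ)`: the tempered distribution `u` is a function `f` for which
`x ↦ e^{A|x|²} f(x)` is in `L^p`. -/
def GaussianMulMemLp {n : ℕ} (A : ℝ) (p : ℝ≥0∞) (u : 𝓢'(EuclideanSpace ℝ (Fin n), ℂ)) : Prop :=
  ∃ f : EuclideanSpace ℝ (Fin n) → ℂ, IsGivenBy u f ∧
    MemLp (fun x => (Real.exp (A * ‖x‖ ^ 2) : ℂ) * f x) p volume

/-- `u = O_{p,q}(A₁; A₂)`: `e^{A₁|·|²} u ∈ L^p` and `e^{A₂|·|²} û ∈ L^q`. -/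
def IsGaussianO {n : ℕ} (p q : ℝ≥0∞) (A₁ A₂ : ℝ) (u : 𝓢'(EuclideanSpace ℝ (Fin n), ℂ)) : Prop :=
  GaussianMulMemLp A₁ p u ∧ GaussianMulMemLp A₂ q (hatTempered n u)

end

/-! The Gaussian-window short-time Fourier transform of `F = 𝓕 u₀` measures `u₀` near each
phase-space point `(x, ξ)`. If `e^{itΔ} u₀` is given by `f`, then `F` is `𝓕 f` times the chirp of
rate `a = 4π²t`. Moving the chirp and `𝓕` onto the packet gives a Gaussian centred at `x + 4πtξ`, so
decay of `f` becomes decay of the transform in `x + 4πtξ`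
(`norm_packetTransform_chirp_mul_fourier_le`). Two distinct times control two independent
combinations of `x` and `ξ`, hence all of phase space (`norm_le_gaussian_of_le_of_le`). Integrating
out `x` or `ξ` returns pointwise Gaussian bounds on `F` and `𝓕⁻ F`
(`norm_le_gaussian_of_packetTransform`). -/

noncomputable section

/-! ### Wave packets and Gaussian bounds on phase space. -/

section WavePackets

open Complex (I)
open Real (pi)

variable {V : Type*} [NormedAddCommGroup V]

theorem exp_neg_mul_sq_norm_sub_le {k κ c : ℝ} (hk : 2 * c ≤ k) (hκ : 2 * c ≤ κ) (hc : 0 ≤ c)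
    (z y : V) :
    Real.exp (-k * ‖z - y‖ ^ 2) ≤ Real.exp (-c * ‖z‖ ^ 2) * Real.exp (κ * ‖y‖ ^ 2) := by
  rw [← Real.exp_add, Real.exp_le_exp]
  have h1 : ‖z‖ ≤ ‖z - y‖ + ‖y‖ := by simpa using norm_add_le (z - y) y
  have h2 : ‖z‖ ^ 2 ≤ 2 * ‖z - y‖ ^ 2 + 2 * ‖y‖ ^ 2 := by
    nlinarith [sq_nonneg (‖z - y‖ - ‖y‖), norm_nonneg z]
  nlinarith [sq_nonneg ‖z - y‖, sq_nonneg ‖y‖, mul_le_mul_of_nonneg_left h2 hc]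

variable [InnerProductSpace ℝ V]

/-- A Gaussian wave packet centred at the frequency `ξ`, multiplied by the chirp of rate `a`. -/
def wavePacket (a : ℝ) (x ξ η : V) : ℂ :=
  Complex.exp (-pi * ‖η - ξ‖ ^ 2 + 2 * pi * I * (inner ℝ x η : ℝ) + a * I * ‖η‖ ^ 2)

theorem norm_wavePacket (a : ℝ) (x ξ η : V) :
    ‖wavePacket a x ξ η‖ = Real.exp (-pi * ‖η - ξ‖ ^ 2) := by
  rw [wavePacket, Complex.norm_exp]
  have : -pi * (‖η - ξ‖ : ℂ) ^ 2 + 2 * pi * I * (inner ℝ x η : ℝ) + a * I * (‖η‖ : ℂ) ^ 2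
      = ((-pi * ‖η - ξ‖ ^ 2 : ℝ) : ℂ) + ((2 * pi * inner ℝ x η + a * ‖η‖ ^ 2 : ℝ) : ℂ) * I := by
    push_cast; ring
  rw [this]
  simp [-Complex.ofReal_mul, -Complex.ofReal_add, -Complex.ofReal_neg, -Complex.ofReal_pow]

theorem continuous_wavePacket (a : ℝ) (x : V) :
    Continuous fun p : V × V => wavePacket a x p.1 p.2 := by
  unfold wavePacket
  fun_prop

theorem wavePacket_eq_mul_chirp (a : ℝ) (x ξ η : V) :
    wavePacket a x ξ η = wavePacket 0 x ξ η * Complex.exp (((a * ‖η‖ ^ 2 : ℝ) : ℂ) * I) := by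
  rw [wavePacket, wavePacket, ← Complex.exp_add]
  congr 1
  push_cast
  ring

theorem exists_sq_norm_add_sq_norm_le {p q : ℝ} (hpq : p ≠ q) : ∃ δ : ℝ, 0 < δ ∧ ∀ x ξ : V,
    δ * (‖x‖ ^ 2 + ‖ξ‖ ^ 2) ≤ ‖x + p • ξ‖ ^ 2 + ‖x + q • ξ‖ ^ 2 := by
  have hd : 0 < (q - p) ^ 2 := by have := sub_ne_zero.2 hpq.symm; positivity
  refine ⟨(q - p) ^ 2 / (2 * (1 + p ^ 2 + q ^ 2)), by positivity, fun x ξ => ?_⟩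
  rw [div_mul_eq_mul_div, div_le_iff₀ (by positivity), norm_add_sq_real, norm_add_sq_real,
    inner_smul_right, inner_smul_right, norm_smul, norm_smul, mul_pow, mul_pow, Real.norm_eq_abs,
    Real.norm_eq_abs, sq_abs, sq_abs]
  have key : ∀ s t : ℝ, 0 ≤ ‖s • x + t • ξ‖ ^ 2 := fun s t => sq_nonneg _
  have key' : ∀ s t : ℝ, 0 ≤ s ^ 2 * ‖x‖ ^ 2 + 2 * s * t * inner ℝ x ξ + t ^ 2 * ‖ξ‖ ^ 2 := by
    intro s t
    have h := key s t
    rw [norm_add_sq_real, inner_smul_right, real_inner_smul_left, norm_smul, norm_smul, mul_pow,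
      mul_pow, Real.norm_eq_abs, Real.norm_eq_abs, sq_abs, sq_abs] at h
    linarith
  -- With `Q` the right-hand side of the claim before scaling, these two squares add up to `(2 + p²
  -- + q²) Q - (q - p)² (‖x‖² + ‖ξ‖²)`: trace and determinant of the form `Q`.
  nlinarith [key' 2 (p + q), key' (p + q) (p ^ 2 + q ^ 2)]

/-- At each point the bound with the larger of the two norms is used; its square is at least half
their sum. -/
theorem norm_le_gaussian_of_le_of_le {W : V → V → ℂ} {p q : ℝ} (hpq : p ≠ q)
    (hp : ∃ C c : ℝ, 0 ≤ C ∧ 0 < c ∧ ∀ x ξ, ‖W x ξ‖ ≤ C * Real.exp (-c * ‖x + p • ξ‖ ^ 2))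
    (hq : ∃ C c : ℝ, 0 ≤ C ∧ 0 < c ∧ ∀ x ξ, ‖W x ξ‖ ≤ C * Real.exp (-c * ‖x + q • ξ‖ ^ 2)) :
    ∃ C c : ℝ, 0 ≤ C ∧ 0 < c ∧ ∀ x ξ,
      ‖W x ξ‖ ≤ C * (Real.exp (-c * ‖x‖ ^ 2) * Real.exp (-c * ‖ξ‖ ^ 2)) := by
  obtain ⟨C, c, hC, hc, hW⟩ := hp
  obtain ⟨D, d, hD, hd, hW'⟩ := hq
  obtain ⟨δ, hδ, hle⟩ := exists_sq_norm_add_sq_norm_le (V := V) hpq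
  have hm : 0 < min c d := lt_min hc hd
  refine ⟨C + D, min c d * δ / 2, by positivity, by positivity, fun x ξ => ?_⟩
  rw [← Real.exp_add]
  have h := mul_le_mul_of_nonneg_left (hle x ξ) hm.le
  have h1 := min_le_left c d
  have h2 := min_le_right c d
  rcases le_total (‖x + p • ξ‖ ^ 2) (‖x + q • ξ‖ ^ 2) with hpq' | hpq'
  · refine (hW' x ξ).trans (mul_le_mul (by linarith) (Real.exp_le_exp.2 ?_) (Real.exp_pos _).le
      (by positivity))
    nlinarith [mul_le_mul_of_nonneg_left hpq' hm.le,
      mul_le_mul_of_nonneg_right h2 (sq_nonneg ‖x + q • ξ‖)]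
  · refine (hW x ξ).trans (mul_le_mul (by linarith) (Real.exp_le_exp.2 ?_) (Real.exp_pos _).le
      (by positivity))
    nlinarith [mul_le_mul_of_nonneg_left hpq' hm.le,
      mul_le_mul_of_nonneg_right h1 (sq_nonneg ‖x + p • ξ‖)]

variable [FiniteDimensional ℝ V] [MeasurableSpace V] [BorelSpace V]

theorem integrable_exp_neg_mul_sq_norm {c : ℝ} (hc : 0 < c) :
    Integrable (fun x : V => Real.exp (-c * ‖x‖ ^ 2)) := by
  have h := (GaussianFourier.integrable_cexp_neg_mul_sq_norm_add (b := (c : ℂ))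
    (by simpa using hc) 0 (0 : V)).norm
  refine h.congr (Filter.Eventually.of_forall fun x => ?_)
  simp only [Complex.norm_exp]
  norm_cast
  simp

theorem integrable_wavePacket (a : ℝ) (x ξ : V) : Integrable (wavePacket a x ξ) := by
  refine ((integrable_exp_neg_mul_sq_norm (V := V) Real.pi_pos).comp_sub_right ξ).mono'
    ((continuous_wavePacket a x).comp (Continuous.prodMk_right ξ)).aestronglyMeasurable
    (Filter.Eventually.of_forall fun η => (norm_wavePacket a x ξ η).le)

/-- The phase `2π⟨x, η⟩ + a‖η‖²` has gradient `2π(x + (a/π)ξ)` at `η = ξ`, which locates the centre.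
The rate `k = π² Re (1/b)` depends on `a` alone. -/
theorem norm_fourier_wavePacket (a : ℝ) : ∃ K k : ℝ, 0 ≤ K ∧ 0 < k ∧ ∀ x ξ y : V,
    ‖𝓕 (wavePacket a x ξ) y‖ = K * Real.exp (-k * ‖x + (a / pi) • ξ - y‖ ^ 2) := by
  set b : ℂ := pi - a * I with hb
  have hbre : b.re = pi := by simp [hb]
  have hbim : b.im = -a := by simp [hb]
  have hb0 : 0 < b.re := hbre ▸ Real.pi_pos
  have hbn : 0 < Complex.normSq b := Complex.normSq_pos.2 fun h => by simp [h] at hb0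
  refine ⟨‖((pi : ℂ) / b) ^ ((Module.finrank ℝ V : ℂ) / 2)‖, pi ^ 2 * (pi / Complex.normSq b),
    norm_nonneg _, by have := Real.pi_pos; positivity, fun x ξ y => ?_⟩
  set w : V := x + (a / pi) • ξ - y with hw
  have h1 : 𝓕 (wavePacket a x ξ) y =
      Complex.exp (((a * ‖ξ‖ ^ 2 + 2 * pi * inner ℝ x ξ - 2 * pi * inner ℝ ξ y : ℝ) : ℂ) * I) *
        ∫ v : V, Complex.exp (-b * ‖v‖ ^ 2 + (2 * pi * I) * (inner ℝ w v : ℝ)) := by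
    rw [Real.fourier_eq', ← integral_add_right_eq_self _ ξ, ← integral_const_mul]
    refine integral_congr_ae (Filter.Eventually.of_forall fun v => ?_)
    simp only [wavePacket, smul_eq_mul, ← Complex.exp_add]
    congr 1
    have e1 : ‖v + ξ‖ ^ 2 = ‖v‖ ^ 2 + 2 * inner ℝ ξ v + ‖ξ‖ ^ 2 := by
      rw [norm_add_sq_real, real_inner_comm]
    have e2 : inner ℝ w v = inner ℝ x v + a / pi * inner ℝ ξ v - inner ℝ v y := by
      rw [hw, inner_sub_left, inner_add_left, real_inner_smul_left, real_inner_comm y v]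
    have e3 : (‖v + ξ‖ : ℂ) ^ 2 = ‖v‖ ^ 2 + 2 * (inner ℝ ξ v : ℝ) + ‖ξ‖ ^ 2 := by
      exact_mod_cast congrArg Complex.ofReal e1
    rw [add_sub_cancel_right, e2, e3, inner_add_left, inner_add_right, hb]
    have hpi : (pi : ℂ) ≠ 0 := by exact_mod_cast Real.pi_ne_zero
    push_cast
    field_simp
    ring
  rw [h1, norm_mul, Complex.norm_exp_ofReal_mul_I, one_mul,
    GaussianFourier.integral_cexp_neg_mul_sq_norm_add hb0, norm_mul, Complex.norm_exp]
  congr 2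
  have h2 : (2 * pi * I) ^ 2 * (‖w‖ : ℂ) ^ 2 / (4 * b) = ((-(pi ^ 2 * ‖w‖ ^ 2) : ℝ) : ℂ) * b⁻¹ := by
    rw [mul_pow, Complex.I_sq, div_eq_mul_inv, mul_inv]
    push_cast
    ring
  rw [h2, Complex.re_ofReal_mul, Complex.inv_re, hbre]
  ring

theorem integral_fourier_mul_eq {f g : V → ℂ} (hf : Integrable f) (hg : Integrable g) :
    ∫ ξ, 𝓕 f ξ * g ξ = ∫ x, f x * 𝓕 g x := by
  have h := VectorFourier.integral_fourierIntegral_smul_eq_flip (L := innerₗ V)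
    Real.continuous_fourierChar continuous_inner hf hg
  rw [flip_innerₗ] at h
  exact h

theorem continuous_fourier_of_integrable {f : V → ℂ} (hf : Integrable f) : Continuous (𝓕 f) :=
  VectorFourier.fourierIntegral_continuous Real.continuous_fourierChar
    (L := innerₗ V) continuous_inner hf

theorem norm_fourier_le {f : V → ℂ} (ξ : V) : ‖𝓕 f ξ‖ ≤ ∫ x, ‖f x‖ :=
  VectorFourier.norm_fourierIntegral_le_integral_norm _ _ _ _ _

/-! ### The short-time Fourier transform: decay estimate and inversion. -/

/-- The short-time Fourier transform with a Gaussian window. -/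
def packetTransform (F : V → ℂ) (x ξ : V) : ℂ := ∫ η, wavePacket 0 x ξ η * F η

theorem packetTransform_chirp_mul_fourier (a : ℝ) {f : V → ℂ} (hf : Integrable f) (x ξ : V) :
    packetTransform (fun η => Complex.exp (((a * ‖η‖ ^ 2 : ℝ) : ℂ) * I) * 𝓕 f η) x ξ =
      ∫ y, f y * 𝓕 (wavePacket a x ξ) y := by
  rw [← integral_fourier_mul_eq hf (integrable_wavePacket a x ξ), packetTransform]
  refine integral_congr_ae (Filter.Eventually.of_forall fun η => ?_)
  simp only [wavePacket_eq_mul_chirp a]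
  ring

theorem norm_packetTransform_chirp_mul_fourier_le (a : ℝ) {f : V → ℂ} (hf : Integrable f) {κ : ℝ}
    (hκ : 0 < κ) (hfκ : Integrable fun y => Real.exp (κ * ‖y‖ ^ 2) * ‖f y‖) :
    ∃ C c : ℝ, 0 ≤ C ∧ 0 < c ∧ ∀ x ξ : V,
      ‖packetTransform (fun η => Complex.exp (((a * ‖η‖ ^ 2 : ℝ) : ℂ) * I) * 𝓕 f η) x ξ‖ ≤
        C * Real.exp (-c * ‖x + (a / pi) • ξ‖ ^ 2) := by
  obtain ⟨K, k, hK, hk, hKk⟩ := norm_fourier_wavePacket (V := V) a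
  have hc : 0 < min k κ / 2 := by have := lt_min hk hκ; linarith
  refine ⟨K * ∫ y, Real.exp (κ * ‖y‖ ^ 2) * ‖f y‖, min k κ / 2,
    mul_nonneg hK (integral_nonneg fun y => by positivity), hc, fun x ξ => ?_⟩
  rw [packetTransform_chirp_mul_fourier a hf, mul_right_comm, ← integral_const_mul]
  refine norm_integral_le_of_norm_le (hfκ.const_mul _) (Filter.Eventually.of_forall fun y => ?_)
  rw [norm_mul, hKk]
  have h := exp_neg_mul_sq_norm_sub_le (k := k) (κ := κ) (c := min k κ / 2)
    (by linarith [min_le_left k κ]) (by linarith [min_le_right k κ]) hc.le (x + (a / pi) • ξ) y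
  calc ‖f y‖ * (K * Real.exp (-k * ‖x + (a / pi) • ξ - y‖ ^ 2))
      ≤ ‖f y‖ * (K * (Real.exp (-(min k κ / 2) * ‖x + (a / pi) • ξ‖ ^ 2) *
          Real.exp (κ * ‖y‖ ^ 2))) := by gcongr
    _ = _ := by ring

theorem packetTransform_eq_fourierInv (F : V → ℂ) (x ξ : V) :
    packetTransform F x ξ = 𝓕⁻ (fun η => wavePacket 0 0 ξ η * F η) x := by
  rw [Real.fourierInv_eq', packetTransform]
  refine integral_congr_ae (Filter.Eventually.of_forall fun η => ?_)
  simp only [wavePacket, smul_eq_mul, ← mul_assoc, ← Complex.exp_add]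
  congr 2
  rw [real_inner_comm x η, inner_zero_left]
  push_cast
  ring

/-- For fixed `ξ` the transform is an inverse Fourier transform in `x`. Fourier inversion evaluated
at `η = ξ`, where the packet equals `1`, recovers `F ξ`. -/
theorem norm_le_integral_norm_packetTransform {F : V → ℂ} (hF : Continuous F) {M : ℝ}
    (hM : ∀ η, ‖F η‖ ≤ M) (ξ : V) (hW : Integrable fun x => packetTransform F x ξ) :
    ‖F ξ‖ ≤ ∫ x, ‖packetTransform F x ξ‖ := by
  have hc : Continuous fun η => wavePacket 0 0 ξ η * F η :=
    ((continuous_wavePacket 0 0).comp (Continuous.prodMk_right ξ)).mul hF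
  have hi : Integrable fun η => wavePacket 0 0 ξ η * F η :=
    (integrable_wavePacket 0 0 ξ).mul_bdd hF.aestronglyMeasurable
      (Filter.Eventually.of_forall hM)
  have hW' : (fun x => packetTransform F x ξ) = 𝓕⁻ (fun η => wavePacket 0 0 ξ η * F η) :=
    funext fun x => packetTransform_eq_fourierInv F x ξ
  have h𝓕 : Integrable (𝓕 fun η => wavePacket 0 0 ξ η * F η) := by
    rw [hW'] at hW
    refine hW.comp_neg.congr (Filter.Eventually.of_forall fun x => ?_)
    simp [Real.fourierInv_eq_fourier_neg]
  have h := congrFun (hc.fourier_fourierInv_eq hi h𝓕) ξ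
  rw [← hW'] at h
  have h0 : wavePacket 0 0 ξ ξ = 1 := by simp [wavePacket]
  rw [h0, one_mul] at h
  rw [← h]
  exact norm_fourier_le ξ

/-- The window has total mass `1`, so packets integrated over their centres `ξ` give the plane wave;
Fubini does the rest. -/
theorem fourierInv_eq_integral_packetTransform {F : V → ℂ} (hF : Integrable F)
    (x : V) : 𝓕⁻ F x = ∫ ξ, packetTransform F x ξ := by
  unfold packetTransform
  have hint : Integrable (Function.uncurry fun ξ η => wavePacket 0 x ξ η * F η)
      ((volume : Measure V).prod volume) := by
    have h := (Integrable.convolution_integrand (ContinuousLinearMap.mul ℝ ℝ) hF.norm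
      (integrable_exp_neg_mul_sq_norm (V := V) Real.pi_pos))
    refine h.mono' ((continuous_wavePacket 0 x).aestronglyMeasurable.mul
      hF.aestronglyMeasurable.comp_snd) (Filter.Eventually.of_forall fun p => ?_)
    simp only [Function.uncurry, norm_mul, norm_wavePacket, ContinuousLinearMap.mul_apply']
    rw [mul_comm, norm_sub_rev]
  rw [integral_integral_swap hint, Real.fourierInv_eq']
  refine integral_congr_ae (Filter.Eventually.of_forall fun η => ?_)
  simp only [smul_eq_mul]
  rw [integral_mul_const]
  congr 1
  have h1 : ∀ ξ : V, wavePacket 0 x ξ η =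
      Complex.exp (((2 * pi * inner ℝ η x : ℝ) : ℂ) * I) *
        Complex.exp (-(pi : ℂ) * ‖ξ - η‖ ^ 2) := by
    intro ξ
    rw [wavePacket, ← Complex.exp_add, norm_sub_rev η ξ, real_inner_comm η x]
    congr 1
    push_cast
    ring
  simp_rw [h1]
  rw [integral_const_mul,
    integral_sub_right_eq_self (fun ξ : V => Complex.exp (-(pi : ℂ) * ‖ξ‖ ^ 2)) η,
    GaussianFourier.integral_cexp_neg_mul_sq_norm (by simpa using Real.pi_pos),
    div_self (by exact_mod_cast Real.pi_ne_zero), Complex.one_cpow, mul_one]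

/-- A function on phase space with Gaussian decay as a short-time Fourier transform forces
Gaussian decay of both the function and its inverse Fourier transform. -/
theorem norm_le_gaussian_of_packetTransform {F : V → ℂ} (hF : Continuous F) {M : ℝ}
    (hM : ∀ η, ‖F η‖ ≤ M) {C c : ℝ} (hc : 0 < c)
    (hW : ∀ x ξ, ‖packetTransform F x ξ‖ ≤
      C * (Real.exp (-c * ‖x‖ ^ 2) * Real.exp (-c * ‖ξ‖ ^ 2))) :
    ∃ D : ℝ, (∀ ξ, ‖F ξ‖ ≤ D * Real.exp (-c * ‖ξ‖ ^ 2)) ∧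
      ∀ x, ‖𝓕⁻ F x‖ ≤ D * Real.exp (-c * ‖x‖ ^ 2) := by
  have hG := integrable_exp_neg_mul_sq_norm (V := V) hc
  set D := C * ∫ x : V, Real.exp (-c * ‖x‖ ^ 2) with hD
  have h1 : ∀ ξ, ‖F ξ‖ ≤ D * Real.exp (-c * ‖ξ‖ ^ 2) := by
    intro ξ
    have hb : Integrable fun x : V =>
        C * (Real.exp (-c * ‖x‖ ^ 2) * Real.exp (-c * ‖ξ‖ ^ 2)) := (hG.mul_const _).const_mul C
    have hi : Integrable fun η => wavePacket 0 0 ξ η * F η :=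
      (integrable_wavePacket 0 0 ξ).mul_bdd hF.aestronglyMeasurable
        (Filter.Eventually.of_forall hM)
    have hm : Continuous fun x => packetTransform F x ξ := by
      simp_rw [packetTransform_eq_fourierInv, Real.fourierInv_eq_fourier_neg]
      exact (continuous_fourier_of_integrable hi).comp continuous_neg
    have hWi : Integrable fun x => packetTransform F x ξ :=
      hb.mono' hm.aestronglyMeasurable (Filter.Eventually.of_forall fun x => hW x ξ)
    refine (norm_le_integral_norm_packetTransform hF hM ξ hWi).trans
      ((integral_mono hWi.norm hb fun x => hW x ξ).trans_eq ?_)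
    rw [integral_const_mul, integral_mul_const, hD]
    ring
  refine ⟨D, h1, fun x => ?_⟩
  have hFi : Integrable F := (hG.const_mul D).mono' hF.aestronglyMeasurable
    (Filter.Eventually.of_forall h1)
  rw [fourierInv_eq_integral_packetTransform hFi]
  refine (norm_integral_le_of_norm_le ((hG.const_mul _).const_mul C)
    (Filter.Eventually.of_forall fun ξ => hW x ξ)).trans_eq ?_
  rw [integral_const_mul, integral_const_mul, hD]
  ring

end WavePackets
end

noncomputable section

/-! ### From tempered distributions to functions and back. -/

section GaussianDecay

open Complex (I)
open Real (pi)

variable {n : ℕ}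

theorem integrable_exp_mul_norm_of_memLp {f : EuclideanSpace ℝ (Fin n) → ℂ} {μ : ℝ} (hμ : 0 < μ)
    (hf : MemLp f 2 (volume.withDensity fun x => ENNReal.ofReal (Real.exp (2 * μ * ‖x‖ ^ 2)))) :
    AEStronglyMeasurable f ∧ Integrable fun y => Real.exp (μ / 2 * ‖y‖ ^ 2) * ‖f y‖ := by
  have hm : Measurable fun x : EuclideanSpace ℝ (Fin n) =>
      ENNReal.ofReal (Real.exp (2 * μ * ‖x‖ ^ 2)) := by fun_prop
  have hfm : AEStronglyMeasurable f :=
    hf.1.mono_ac (withDensity_absolutelyContinuous' hm.aemeasurable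
      (Filter.Eventually.of_forall fun x => by simp [Real.exp_pos]))
  have h2 := (memLp_two_iff_integrable_sq_norm hf.1).1 hf
  rw [integrable_withDensity_iff hm (Filter.Eventually.of_forall fun x => ENNReal.ofReal_lt_top)]
    at h2
  have hg := integrable_exp_neg_mul_sq_norm (V := EuclideanSpace ℝ (Fin n)) hμ
  have hcont : Continuous fun y : EuclideanSpace ℝ (Fin n) => Real.exp (μ / 2 * ‖y‖ ^ 2) := by
    fun_prop
  refine ⟨hfm, (h2.add hg).mono' (hcont.aestronglyMeasurable.mul hfm.norm)
    (Filter.Eventually.of_forall fun y => ?_)⟩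
  rw [Real.norm_of_nonneg (by positivity)]
  simp only [Pi.add_apply, ENNReal.toReal_ofReal (Real.exp_pos _).le]
  -- The integrand is `p * q ≤ p² + q²`, with `p²` integrable by hypothesis and `q²` a Gaussian.
  set p := Real.exp (μ * ‖y‖ ^ 2) * ‖f y‖ with hp
  set q := Real.exp (-(μ / 2) * ‖y‖ ^ 2) with hq
  have e1 : Real.exp (μ / 2 * ‖y‖ ^ 2) * ‖f y‖ = p * q := by
    rw [hp, hq, mul_right_comm, ← Real.exp_add]; ring_nf
  have e2 : ‖f y‖ ^ 2 * Real.exp (2 * μ * ‖y‖ ^ 2) = p ^ 2 := by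
    rw [hp, mul_pow, ← Real.exp_nat_mul, mul_comm]; push_cast; ring_nf
  have e3 : Real.exp (-μ * ‖y‖ ^ 2) = q ^ 2 := by
    rw [hq, ← Real.exp_nat_mul]; push_cast; ring_nf
  rw [e1, e2, e3]
  nlinarith [sq_nonneg (p - q), sq_nonneg p, sq_nonneg q]

theorem MemGaussianWeightedL2.exists_integrable {μ : ℝ} (hμ : 0 < μ)
    {u : 𝓢'(EuclideanSpace ℝ (Fin n), ℂ)} (hu : MemGaussianWeightedL2 (2 * μ) u) :
    ∃ f : EuclideanSpace ℝ (Fin n) → ℂ, IsGivenBy u f ∧ Integrable f ∧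
      Integrable fun y => Real.exp (μ / 2 * ‖y‖ ^ 2) * ‖f y‖ := by
  obtain ⟨f, hf, hmem⟩ := hu
  obtain ⟨hm, hi⟩ := integrable_exp_mul_norm_of_memLp hμ hmem
  refine ⟨f, hf, hi.mono' hm (Filter.Eventually.of_forall fun y => ?_), hi⟩
  exact le_mul_of_one_le_left (norm_nonneg _) (Real.one_le_exp (by positivity))

/-- The function representing `𝓕 u₀` when `e^{itΔ} u₀` is given by `f`. -/
def backPropagatedFourier (t : ℝ) (f : EuclideanSpace ℝ (Fin n) → ℂ) :
    EuclideanSpace ℝ (Fin n) → ℂ :=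
  fun η => Complex.exp (((t * (2 * pi) ^ 2 * ‖η‖ ^ 2 : ℝ) : ℂ) * I) * 𝓕 f η

theorem continuous_backPropagatedFourier (t : ℝ) {f : EuclideanSpace ℝ (Fin n) → ℂ}
    (hf : Integrable f) : Continuous (backPropagatedFourier t f) := by
  have := continuous_fourier_of_integrable hf
  unfold backPropagatedFourier
  fun_prop

theorem norm_backPropagatedFourier_le (t : ℝ) (f : EuclideanSpace ℝ (Fin n) → ℂ)
    (η : EuclideanSpace ℝ (Fin n)) : ‖backPropagatedFourier t f η‖ ≤ ∫ x, ‖f x‖ := by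
  rw [backPropagatedFourier, norm_mul, Complex.norm_exp_ofReal_mul_I, one_mul]
  exact norm_fourier_le η

theorem fourier_apply_eq_integral_backPropagatedFourier (u : 𝓢'(EuclideanSpace ℝ (Fin n), ℂ))
    (t : ℝ) {f : EuclideanSpace ℝ (Fin n) → ℂ} (hf : Integrable f)
    (hu : IsGivenBy (freeSchrodinger n t u) f) (φ : 𝓢(EuclideanSpace ℝ (Fin n), ℂ)) :
    𝓕 u φ = ∫ x, φ x * backPropagatedFourier t f x := by
  have hs := freeSymbol_hasTemperateGrowth n
  have hinv : freeSymbol n t * freeSymbol n (-t) = fun _ => 1 := by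
    funext ξ
    rw [Pi.mul_apply, freeSymbol, freeSymbol, ← Complex.exp_add, ← Complex.exp_zero]
    congr 1
    push_cast
    ring
  -- Testing the evolved distribution on `𝓕 ψ` undoes the evolution, since the symbols at `t` and
  -- `-t` cancel.
  set ψ := SchwartzMap.smulLeftCLM ℂ (freeSymbol n (-t)) φ with hψ
  have h1 : freeSchrodinger n t u (𝓕 ψ) = 𝓕 u φ := by
    rw [freeSchrodinger, TemperedDistribution.fourierMultiplierCLM_apply,
      TemperedDistribution.fourierInv_apply, FourierTransform.fourierInv_fourier_eq,
      TemperedDistribution.smulLeftCLM_apply_apply, hψ,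
      SchwartzMap.smulLeftCLM_smulLeftCLM_apply (hs t) (hs (-t)), hinv]
    simp
  rw [← h1, (hu _).2]
  have h2 := integral_fourier_mul_eq ψ.integrable hf
  rw [SchwartzMap.fourier_coe, h2]
  refine integral_congr_ae (Filter.Eventually.of_forall fun x => ?_)
  simp only [hψ, SchwartzMap.smulLeftCLM_apply_apply (hs (-t)), smul_eq_mul, freeSymbol,
    backPropagatedFourier]
  rw [mul_assoc, mul_left_comm]
  congr 3
  push_cast
  ring

theorem eq_of_forall_integral_schwartz_mul_eq {F G : EuclideanSpace ℝ (Fin n) → ℂ}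
    (hF : Continuous F) (hG : Continuous G)
    (h : ∀ φ : 𝓢(EuclideanSpace ℝ (Fin n), ℂ), ∫ x, φ x * F x = ∫ x, φ x * G x) : F = G := by
  refine (Continuous.ae_eq_iff_eq volume hF hG).1 (ae_eq_of_integral_contDiff_smul_eq
    hF.locallyIntegrable hG.locallyIntegrable fun g hg hgs => ?_)
  have hc : ContDiff ℝ (⊤ : ℕ∞) fun x => (g x : ℂ) := Complex.ofRealCLM.contDiff.comp hg
  have hs : HasCompactSupport fun x => (g x : ℂ) := hgs.comp_left Complex.ofReal_zero
  simpa [Complex.real_smul] using h (hs.toSchwartzMap hc)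

theorem isGivenBy_of_bounded {u : 𝓢'(EuclideanSpace ℝ (Fin n), ℂ)}
    {f : EuclideanSpace ℝ (Fin n) → ℂ} (hf : Continuous f) {M : ℝ} (hM : ∀ x, ‖f x‖ ≤ M)
    (h : ∀ φ : 𝓢(EuclideanSpace ℝ (Fin n), ℂ), u φ = ∫ x, φ x * f x) : IsGivenBy u f :=
  fun φ => ⟨φ.integrable.mul_bdd hf.aestronglyMeasurable (Filter.Eventually.of_forall hM), h φ⟩

theorem IsGivenBy.gaussianMulMemLp {u : 𝓢'(EuclideanSpace ℝ (Fin n), ℂ)}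
    {f : EuclideanSpace ℝ (Fin n) → ℂ} (hu : IsGivenBy u f) (hf : Continuous f) {D c : ℝ}
    (hc : 0 < c) (hD : ∀ x, ‖f x‖ ≤ D * Real.exp (-c * ‖x‖ ^ 2)) :
    GaussianMulMemLp (c / 2) 2 u := by
  have hcont : Continuous fun x => (Real.exp (c / 2 * ‖x‖ ^ 2) : ℂ) * f x := by fun_prop
  refine ⟨f, hu, (memLp_two_iff_integrable_sq_norm hcont.aestronglyMeasurable).2 ?_⟩
  refine ((integrable_exp_neg_mul_sq_norm hc).const_mul (D ^ 2)).mono'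
    (hcont.norm.pow 2).aestronglyMeasurable (Filter.Eventually.of_forall fun x => ?_)
  have h1 : ‖(Real.exp (c / 2 * ‖x‖ ^ 2) : ℂ) * f x‖ ≤ D * Real.exp (-(c / 2) * ‖x‖ ^ 2) := by
    rw [norm_mul, Complex.norm_of_nonneg (Real.exp_pos _).le]
    refine (mul_le_mul_of_nonneg_left (hD x) (Real.exp_pos _).le).trans_eq ?_
    rw [mul_left_comm, ← Real.exp_add]
    ring_nf
  rw [Real.norm_of_nonneg (by positivity)]
  refine (pow_le_pow_left₀ (norm_nonneg _) h1 2).trans_eq ?_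
  rw [mul_pow, ← Real.exp_nat_mul]
  push_cast
  ring_nf

theorem apply_eq_integral_fourierInv {u : 𝓢'(EuclideanSpace ℝ (Fin n), ℂ)}
    {F : EuclideanSpace ℝ (Fin n) → ℂ} (hF : Integrable F)
    (hu : ∀ φ : 𝓢(EuclideanSpace ℝ (Fin n), ℂ), 𝓕 u φ = ∫ x, φ x * F x)
    (φ : 𝓢(EuclideanSpace ℝ (Fin n), ℂ)) : u φ = ∫ x, φ x * 𝓕⁻ F x := by
  have h1 : 𝓕 u (𝓕⁻ φ) = u φ := by
    rw [TemperedDistribution.fourier_apply, FourierTransform.fourier_fourierInv_eq]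
  rw [← h1, hu, SchwartzMap.fourierInv_coe]
  have h2 := integral_fourier_mul_eq (SchwartzMap.integrable (μ := volume) φ) hF.comp_neg
  rw [← Real.fourierInv_eq_fourier_comp_neg] at h2
  rw [← h2, ← integral_neg_eq_self]
  simp_rw [Real.fourierInv_eq_fourier_neg, neg_neg]

/-- The multiplication formula is used for the character `e^{ix}`, matching `hatSchwartz`; the
dilation by `(2π)⁻¹` then returns to `𝓕`. -/
theorem hatTempered_apply_eq_integral {u : 𝓢'(EuclideanSpace ℝ (Fin n), ℂ)}
    {f : EuclideanSpace ℝ (Fin n) → ℂ} (hf : Integrable f) (hu : IsGivenBy u f)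
    (φ : 𝓢(EuclideanSpace ℝ (Fin n), ℂ)) :
    hatTempered n u φ = ∫ ξ, φ ξ * ((((2 * pi) ^ (-(n : ℝ) / 2) : ℝ) : ℂ) *
      𝓕 f ((2 * pi)⁻¹ • ξ)) := by
  have h := VectorFourier.integral_fourierIntegral_smul_eq_flip (e := Real.probChar)
    (L := innerₗ (EuclideanSpace ℝ (Fin n))) Real.continuous_probChar continuous_inner
    (SchwartzMap.integrable (μ := volume) φ) hf
  rw [flip_innerₗ] at h
  simp only [VectorFourier.fourierIntegral_probChar, innerₗ_apply_apply, smul_eq_mul] at h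
  rw [hatTempered_apply, (hu _).2]
  simp_rw [hatSchwartz_apply, mul_assoc, mul_left_comm (φ _)]
  rw [integral_const_mul, integral_const_mul]
  congr 1
  have e1 : ∀ r : ℝ, -I * (r : ℂ) = -(r : ℂ) * I := fun r => by ring
  simp_rw [e1]
  rw [h]
  refine integral_congr_ae (Filter.Eventually.of_forall fun ξ => ?_)
  simp only [Real.fourier_eq', smul_eq_mul]
  congr 1
  refine integral_congr_ae (Filter.Eventually.of_forall fun x => ?_)
  simp only [inner_smul_right]
  congr 3
  have hpi : (pi : ℂ) ≠ 0 := by exact_mod_cast Real.pi_ne_zero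
  push_cast
  field_simp

end GaussianDecay
end

/-! ### The main theorem. -/

theorem corollary2p1 (n : ℕ) (u₀ : 𝓢'(EuclideanSpace ℝ (Fin n), ℂ))
    (t₁ t₂ : ℝ) (ht : t₁ ≠ t₂) (μ₁ μ₂ : ℝ) (hμ₁ : 0 < μ₁) (hμ₂ : 0 < μ₂)
    (h₁ : MemGaussianWeightedL2 (2 * μ₁) (freeSchrodinger n t₁ u₀))
    (h₂ : MemGaussianWeightedL2 (2 * μ₂) (freeSchrodinger n t₂ u₀)) :
    ∃ A₁ A₂ : ℝ, 0 < A₁ ∧ 0 < A₂ ∧ IsGaussianO 2 2 A₁ A₂ u₀ := by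
  obtain ⟨f₁, hu₁, hf₁, hw₁⟩ := h₁.exists_integrable hμ₁
  obtain ⟨f₂, hu₂, hf₂, hw₂⟩ := h₂.exists_integrable hμ₂
  have hF₁ := fourier_apply_eq_integral_backPropagatedFourier u₀ t₁ hf₁ hu₁
  have hF₂ := fourier_apply_eq_integral_backPropagatedFourier u₀ t₂ hf₂ hu₂
  have hcont := continuous_backPropagatedFourier t₁ hf₁
  have heq : backPropagatedFourier t₁ f₁ = backPropagatedFourier t₂ f₂ :=
    eq_of_forall_integral_schwartz_mul_eq hcont (continuous_backPropagatedFourier t₂ hf₂)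
      fun φ => (hF₁ φ).symm.trans (hF₂ φ)
  have hW₁ := norm_packetTransform_chirp_mul_fourier_le (t₁ * (2 * Real.pi) ^ 2) hf₁
    (half_pos hμ₁) hw₁
  have hW₂ := norm_packetTransform_chirp_mul_fourier_le (t₂ * (2 * Real.pi) ^ 2) hf₂
    (half_pos hμ₂) hw₂
  -- By `heq` both estimates concern the same function, the one representing `𝓕 u₀`.
  change ∃ C c : ℝ, 0 ≤ C ∧ 0 < c ∧ ∀ x ξ,
    ‖packetTransform (backPropagatedFourier t₂ f₂) x ξ‖ ≤ _ at hW₂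
  rw [← heq] at hW₂
  obtain ⟨C, c, -, hc, hW⟩ := norm_le_gaussian_of_le_of_le (fun h => ht (by
    have := Real.pi_pos
    field_simp at h
    exact h)) hW₁ hW₂
  set F := backPropagatedFourier t₁ f₁ with hF
  obtain ⟨D, hD, hD'⟩ := norm_le_gaussian_of_packetTransform hcont
    (norm_backPropagatedFourier_le t₁ f₁) hc hW
  have hbdd : ∀ (G : EuclideanSpace ℝ (Fin n) → ℂ) (D d : ℝ), 0 < d →
      (∀ x, ‖G x‖ ≤ D * Real.exp (-d * ‖x‖ ^ 2)) → ∀ x, ‖G x‖ ≤ D := by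
    intro G D d hd h x
    have hD0 : 0 ≤ D := nonneg_of_mul_nonneg_left ((norm_nonneg _).trans (h x)) (Real.exp_pos _)
    exact (h x).trans (mul_le_of_le_one_right hD0 (Real.exp_le_one_iff.2 (by
      nlinarith [sq_nonneg ‖x‖])))
  have hGi := integrable_exp_neg_mul_sq_norm (V := EuclideanSpace ℝ (Fin n)) hc
  have hFi : Integrable F := (hGi.const_mul D).mono' hcont.aestronglyMeasurable
    (Filter.Eventually.of_forall hD)
  have hUc : Continuous (𝓕⁻ F) := by
    have : 𝓕⁻ F = fun x => 𝓕 F (-x) := funext fun x => Real.fourierInv_eq_fourier_neg F x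
    rw [this]
    exact (continuous_fourier_of_integrable hFi).comp continuous_neg
  have hUi : Integrable (𝓕⁻ F) := (hGi.const_mul D).mono' hUc.aestronglyMeasurable
    (Filter.Eventually.of_forall hD')
  have h𝓕U : 𝓕 (𝓕⁻ F) = F := by
    refine hcont.fourier_fourierInv_eq hFi (hUi.comp_neg.congr
      (Filter.Eventually.of_forall fun x => ?_))
    simp [Real.fourierInv_eq_fourier_neg]
  have hu : IsGivenBy u₀ (𝓕⁻ F) := isGivenBy_of_bounded hUc (hbdd _ D c hc hD')
    (apply_eq_integral_fourierInv hFi hF₁)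
  set K : ℂ := (((2 * Real.pi) ^ (-(n : ℝ) / 2) : ℝ) : ℂ) with hK
  set H : EuclideanSpace ℝ (Fin n) → ℂ := fun ξ => K * F ((2 * Real.pi)⁻¹ • ξ) with hH
  -- The dilation in `H` scales the decay rate by `(2π)⁻²`.
  have hd : 0 < c * ((2 * Real.pi)⁻¹) ^ 2 := by have := Real.pi_pos; positivity
  have hHle : ∀ ξ, ‖H ξ‖ ≤ ‖K‖ * D * Real.exp (-(c * ((2 * Real.pi)⁻¹) ^ 2) * ‖ξ‖ ^ 2) := by
    intro ξ
    rw [hH, norm_mul, mul_assoc]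
    refine (mul_le_mul_of_nonneg_left (hD _) (norm_nonneg K)).trans_eq ?_
    rw [norm_smul, mul_pow, Real.norm_eq_abs, sq_abs]
    ring_nf
  have hHc : Continuous H := by fun_prop
  have hhat : IsGivenBy (hatTempered n u₀) H :=
    isGivenBy_of_bounded hHc (hbdd _ _ _ hd hHle) fun φ => by
      rw [hatTempered_apply_eq_integral hUi hu, h𝓕U]
  -- Half of each pointwise rate goes into the weight; the other half gives square integrability.
  exact ⟨c / 2, c * ((2 * Real.pi)⁻¹) ^ 2 / 2, half_pos hc, half_pos hd,
    hu.gaussianMulMemLp hUc hc hD', hhat.gaussianMulMemLp hHc hd hHle⟩
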